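/- Graphs are simple and undirected; "countable" includes finite (and empty), and existential formulas are formulas $\exists \bar y\,\psi$ with $\psi$ quantifier-free in the first-order language of graphs (adjacency and equality). Let $\mathcal C$ be a finite set of finite connected graphs (connected graphs are nonempty). Let $\mathcal G_{\mathcal C}$ be the class of countable graphs having no subgraph (induced or not) isomorphic to a member of $\mathcal C$, and let $\mathcal E_{\mathcal C}$ be the class of those $G\in\mathcal G_{\mathcal C}$ that are existentially complete: whenever $G$ is an induced subgraph of some $H\in\mathcal G_{\mathcal C}$, every existential formula with parameters from $G$ that is true in $H$ is true in $G$. A graph is universal in a class if it belongs to the class and every graph in the class is isomorphic to an induced subgraph of it. For $G\in\mathcal E_{\mathcal C}$ and $\bar a\in V(G)^n$, let $\mathrm{tp}_G(\bar a)$ be the set of existential formulas $\varphi(x_1,\dots,x_n)$ with $G\models\varphi(\bar a)$, and let $S_n(T^*_{\mathcal C})$ be the set of all $\mathrm{tp}_G(\bar a)$ with $G\in\mathcal E_{\mathcal C}$ and $\bar a\in V(G)^n$ (here $T^*_{\mathcal C}$ denotes the first-order theory of $\mathcal E_{\mathcal C}$). A graph $G\in\mathcal E_{\mathcal C}$ is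 $\aleph_0$-saturated if for all $n\ge 0$, all $\bar a\in V(G)^n$ and all $p\in S_{n+1}(T^*_{\mathcal C})$ whose restriction to the first $n$ variables is $\mathrm{tp}_G(\bar a)$, there is $v\in V(G)$ with $\mathrm{tp}_G(\bar a,v)=p$. Theorem. The following are equivalent: 1. There is a universal graph in $\mathcal G_{\mathcal C}$. 2. There is a universal graph in $\mathcal E_{\mathcal C}$. 3. $\mathcal E_{\mathcal C}$ contains a unique $\aleph_0$-saturated graph, up to isomorphism (that is, one exists and any two are isomorphic). 4. $S_n(T^*_{\mathcal C})$ is countable for every $n$. -/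

import Mathlib

open FirstOrder

namespace ForbiddenGraphs

/-! Graphs are simple graphs; the graphs under study are countable (finite and empty vertex sets
included), so there is no loss in taking their vertex types in `Type`.
A set of forbidden graphs is an indexed family `C : ∀ i, SimpleGraph (W i)`. -/

/-- `G ⊨ φ(a)`: the formula `φ(x₁, …, xₙ)` in the language of graphs (adjacency and equality)
holds in `G` at the tuple `a`. -/
def Sat {V : Type} (G : SimpleGraph V) {n : ℕ} (φ : Language.graph.Formula (Fin n))
    (a : Fin n → V) : Prop :=
  letI := G.structure
  φ.Realize a

/-- A formula `∃ y₁ … yₖ, ψ` with `ψ` quantifier-free. -/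
def IsExistential {n : ℕ} (φ : Language.graph.Formula (Fin n)) : Prop :=
  Language.BoundedFormula.IsExistential φ

/-- `G` is existentially complete in `H`, where `G` is identified with an induced subgraph of `H`
by `f`: existential statements with parameters in `G` that are true in `H` are true in `G`. -/
def ExistentiallyCompleteIn {V V' : Type} {G : SimpleGraph V} {H : SimpleGraph V'}
    (f : G ↪g H) : Prop :=
  ∀ (n : ℕ) (φ : Language.graph.Formula (Fin n)) (a : Fin n → V),
    IsExistential φ → Sat H φ (f ∘ a) → Sat G φ a

section

universe u w

variable {ι : Type u} {W : ι → Type w}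

/-- `G` omits `C`: no subgraph of `G` (induced or not) is isomorphic to a member of `C`. -/
def Omits (C : ∀ i, SimpleGraph (W i)) {V : Type} (G : SimpleGraph V) : Prop :=
  ∀ i, (C i).Free G

/-- The class `𝒢_C` of countable graphs omitting `C`. -/
def ClassG (C : ∀ i, SimpleGraph (W i)) {V : Type} (G : SimpleGraph V) : Prop :=
  Countable V ∧ Omits C G

/-- The class `ℰ_C` of graphs in `𝒢_C` that are existentially complete in every graph of `𝒢_C`
containing them as an induced subgraph. -/
def ClassE (C : ∀ i, SimpleGraph (W i)) {V : Type} (G : SimpleGraph V) : Prop :=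
  ClassG C G ∧ ∀ (V' : Type) (H : SimpleGraph V') (f : G ↪g H),
    ClassG C H → ExistentiallyCompleteIn f

/-- `G` is universal in the class `K`: it belongs to `K`, and every graph in `K` is isomorphic to
an induced subgraph of `G`. -/
def IsUniversalIn (K : ∀ {V : Type}, SimpleGraph V → Prop) {V : Type} (G : SimpleGraph V) : Prop :=
  K G ∧ ∀ (V' : Type) (H : SimpleGraph V'), K H → Nonempty (H ↪g G)

/-- The existential type `tp_G(a)` of a finite sequence in `G`. -/
def existentialType {V : Type} (G : SimpleGraph V) {n : ℕ} (a : Fin n → V) :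
    Set (Language.graph.Formula (Fin n)) :=
  {φ | IsExistential φ ∧ Sat G φ a}

/-- The space `S_n(T*_C)`: all existential types of sequences of length `n` in graphs of `ℰ_C`. -/
def typeSpace (C : ∀ i, SimpleGraph (W i)) (n : ℕ) : Set (Set (Language.graph.Formula (Fin n))) :=
  {p | ∃ (V : Type) (G : SimpleGraph V) (a : Fin n → V), ClassE C G ∧ p = existentialType G a}

/-- Restriction of an `(n+1)`-type to the first `n` variables. -/
def restrictType {n : ℕ} (p : Set (Language.graph.Formula (Fin (n + 1)))) :
    Set (Language.graph.Formula (Fin n)) :=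
  {φ | IsExistential φ ∧ φ.relabel Fin.castSucc ∈ p}

/-- `G` is an `ℵ₀`-saturated graph of `ℰ_C`. -/
def IsSaturated (C : ∀ i, SimpleGraph (W i)) {V : Type} (G : SimpleGraph V) : Prop :=
  ClassE C G ∧ ∀ (n : ℕ) (a : Fin n → V), ∀ p ∈ typeSpace C (n + 1),
    restrictType p = existentialType G a →
      ∃ v : V, existentialType G (Fin.snoc a v : Fin (n + 1) → V) = p

end

end ForbiddenGraphs

/-! Existential formulas persist under embeddings, and a graph of `ClassE` already satisfies those
true in its extensions in `ClassG`; so existential types of its tuples do not change in such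
extensions. Three constructions carry the proof. Chains: the members of `C` are finite, so both
classes are closed under unions of chains. Hence every graph of `ClassG` extends to one of `ClassE`,
which gives 1 ⇔ 2; and if there are only countably many types, a chain realizing them one by one has
a saturated union. Amalgamation (`exists_amalgam`): if the type of `b` in `H` lies in the type of
`a` in `G`, then `H` embeds in an ultrapower of `G` with `b` going to `a`. Thus types over a tuple
can be realized in extensions. Joint embedding (`classG_sum`): the members of `C` are connected, so
disjoint unions stay in `ClassG` and the empty tuple has only one type. Back-and-forth can start
there; it makes saturated graphs unique and universal. Finally, a countable universal graph of
`ClassE` realizes every type, so there are only countably many. -/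

namespace ForbiddenGraphs

open Language Filter

universe u w

variable {ι : Type u} {W : ι → Type w} {C : ∀ i, SimpleGraph (W i)}

/-! ### Existential types and finite diagrams -/

section Types

variable {V V' V'' : Type} {G : SimpleGraph V} {H : SimpleGraph V'} {n : ℕ}

/-- An embedding of graphs, as an embedding of structures. -/
def structureEmbedding (f : G ↪g H) :
    @Language.Embedding Language.graph V V' G.structure H.structure :=
  letI := G.structure
  letI := H.structure
  { toFun := f
    inj' := f.injective
    map_fun' := fun g => isEmptyElim g
    map_rel' := by
      rintro _ ⟨⟩ x
      exact f.map_adj_iff }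

theorem Sat.map_embedding {φ : Language.graph.Formula (Fin n)} (hφ : IsExistential φ) {a : Fin n → V}
    (f : G ↪g H) (h : Sat G φ a) : Sat H φ (f ∘ a) := by
  let := G.structure
  let := H.structure
  have key := BoundedFormula.IsExistential.realize_embedding hφ (structureEmbedding f) (v := a)
    (xs := default) h
  rwa [Subsingleton.elim (structureEmbedding f ∘ default) default] at key

theorem existentialType_subset_map (f : G ↪g H) (a : Fin n → V) :
    existentialType G a ⊆ existentialType H (f ∘ a) :=
  fun _ h => ⟨h.1, h.2.map_embedding h.1 f⟩

theorem existentialType_map_eq {f : G ↪g H} (hf : ExistentiallyCompleteIn f) (a : Fin n → V) :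
    existentialType H (f ∘ a) = existentialType G a :=
  Set.Subset.antisymm (fun _ h => ⟨h.1, hf _ _ _ h.1 h.2⟩) (existentialType_subset_map f a)

theorem isExistential_exs {k : ℕ} {φ : Language.graph.BoundedFormula (Fin n) k}
    (h : BoundedFormula.IsExistential φ) : IsExistential φ.exs := by
  induction k with
  | zero => exact h
  | succ k ih => exact ih h.ex

theorem isQF_iInf {β : Type} [Finite β] {k : ℕ} {α : Type}
    {f : β → Language.graph.BoundedFormula α k} (h : ∀ b, (f b).IsQF) :
    (BoundedFormula.iInf f).IsQF := by
  dsimp only [BoundedFormula.iInf]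
  generalize Finset.toList _ = l
  induction l with
  | nil => exact BoundedFormula.IsQF.top
  | cons b l ih => exact (h b).inf ih

theorem isExistential_relabel {m : ℕ} {φ : Language.graph.Formula (Fin n)} (hφ : IsExistential φ)
    (g : Fin n → Fin m) : IsExistential (φ.relabel g) := by
  have key : ∀ {k : ℕ} {ψ : Language.graph.BoundedFormula (Fin n) k}, ψ.IsExistential →
      (ψ.relabel (Sum.inl ∘ g : Fin n → Fin m ⊕ Fin 0)).IsExistential := by
    intro k ψ hψ
    induction hψ with
    | of_isQF h => exact (h.relabel _).isExistential
    | ex _ ih =>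
      rw [BoundedFormula.relabel_ex]
      exact ih.ex
  exact key hφ

theorem sat_relabel {m : ℕ} {φ : Language.graph.Formula (Fin n)} {g : Fin n → Fin m}
    {a : Fin m → V} : Sat G (φ.relabel g) a ↔ Sat G φ (a ∘ g) := by
  let := G.structure
  exact Formula.realize_relabel

theorem restrictType_existentialType (a : Fin (n + 1) → V) :
    restrictType (existentialType G a) = existentialType G (a ∘ Fin.castSucc) := by
  ext φ
  constructor
  · rintro ⟨h, -, h'⟩
    exact ⟨h, sat_relabel.1 h'⟩
  · rintro ⟨h, h'⟩
    exact ⟨h, isExistential_relabel h _, sat_relabel.2 h'⟩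

/-- The tuples `a` in `G` and `b` in `H` have the same quantifier-free type. -/
def SameDiagram {I : Type*} (G : SimpleGraph V) (a : I → V) (H : SimpleGraph V') (b : I → V') :
    Prop :=
  ∀ i j, (a i = a j ↔ b i = b j) ∧ (G.Adj (a i) (a j) ↔ H.Adj (b i) (b j))

open Classical in
/-- The literal which describes equality or inequality of two variables in the tuple `a`. -/
noncomputable def eqLiteral {k : ℕ} (a : Fin n ⊕ Fin k → V) (i j : Fin n ⊕ Fin k) :
    Language.graph.BoundedFormula (Fin n) k :=
  if a i = a j then (Term.var i).bdEqual (Term.var j) else ((Term.var i).bdEqual (Term.var j)).not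

open Classical in
/-- The literal which describes adjacency of two variables in the tuple `a`. -/
noncomputable def adjLiteral (G : SimpleGraph V) {k : ℕ} (a : Fin n ⊕ Fin k → V)
    (i j : Fin n ⊕ Fin k) : Language.graph.BoundedFormula (Fin n) k :=
  if G.Adj (a i) (a j) then adj.boundedFormula₂ (Term.var i) (Term.var j)
  else (adj.boundedFormula₂ (Term.var i) (Term.var j)).not

/-- The conjunction of all literals true of the tuple `a`. -/
noncomputable def diagramFormula (G : SimpleGraph V) {k : ℕ} (a : Fin n ⊕ Fin k → V) :
    Language.graph.BoundedFormula (Fin n) k :=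
  BoundedFormula.iInf fun p : (Fin n ⊕ Fin k) × (Fin n ⊕ Fin k) =>
    eqLiteral a p.1 p.2 ⊓ adjLiteral G a p.1 p.2

theorem isQF_diagramFormula {k : ℕ} (a : Fin n ⊕ Fin k → V) : (diagramFormula G a).IsQF := by
  refine isQF_iInf fun p => BoundedFormula.IsQF.inf ?_ ?_
  · unfold eqLiteral
    split_ifs
    · exact (BoundedFormula.IsAtomic.equal _ _).isQF
    · exact (BoundedFormula.IsAtomic.equal _ _).isQF.not
  · unfold adjLiteral
    split_ifs
    · exact (BoundedFormula.IsAtomic.rel _ _).isQF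
    · exact (BoundedFormula.IsAtomic.rel _ _).isQF.not

theorem realize_diagramFormula {k : ℕ} (a : Fin n ⊕ Fin k → V) (b : Fin n → V') (d : Fin k → V') :
    (letI := H.structure; (diagramFormula G a).Realize b d) ↔
      SameDiagram G a H (Sum.elim b d) := by
  let := H.structure
  have hadj : ∀ x y : V', Structure.RelMap adj ![x, y] ↔ H.Adj x y := fun _ _ => Iff.rfl
  simp only [diagramFormula, BoundedFormula.realize_iInf, BoundedFormula.realize_inf, SameDiagram,
    Prod.forall]
  refine forall_congr' fun i => forall_congr' fun j => and_congr ?_ ?_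
  · unfold eqLiteral
    split_ifs with h <;> simp [h, BoundedFormula.realize_bdEqual]
  · unfold adjLiteral
    split_ifs with h <;> simp [h, BoundedFormula.realize_rel₂, hadj]

/-- The language is finite and relational, so the diagram of a finite tuple is one quantifier-free
formula, and the existence of `c` with this diagram over `a` is one existential formula. Negated
literals are included, so an inclusion of types suffices. -/
theorem exists_sameDiagram_of_subset {a : Fin n → V} {b : Fin n → V'}
    (h : existentialType G a ⊆ existentialType H b) {k : ℕ} (c : Fin k → V) :
    ∃ d : Fin k → V', SameDiagram G (Sum.elim a c) H (Sum.elim b d) := by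
  have hsat : Sat G (diagramFormula G (Sum.elim a c)).exs a := by
    let := G.structure
    exact BoundedFormula.realize_exs.2
      ⟨c, (realize_diagramFormula _ _ _).2 fun _ _ => ⟨Iff.rfl, Iff.rfl⟩⟩
  have hsat' := (h ⟨isExistential_exs (isQF_diagramFormula _).isExistential, hsat⟩).2
  let := H.structure
  obtain ⟨d, hd⟩ := BoundedFormula.realize_exs.1 hsat'
  exact ⟨d, (realize_diagramFormula _ _ _).1 hd⟩

theorem SameDiagram.comp {I J : Type*} {a : I → V} {b : I → V'} (h : SameDiagram G a H b)
    (g : J → I) : SameDiagram G (a ∘ g) H (b ∘ g) :=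
  fun _ _ => h _ _

theorem sameDiagram_of_existentialType_eq {a : Fin n → V} {b : Fin n → V'}
    (h : existentialType G a = existentialType H b) : SameDiagram G a H b := by
  obtain ⟨d, hd⟩ := exists_sameDiagram_of_subset h.subset (Fin.elim0 : Fin 0 → V)
  exact hd.comp Sum.inl

end Types

/-! ### Unions of chains -/

section Limits

/-- Union of a countable chain of graphs. -/
theorem exists_limit (V : ℕ → Type) (G : ∀ n, SimpleGraph (V n)) (f : ∀ n, G n ↪g G (n + 1)) :
    ∃ (L : Type) (H : SimpleGraph L) (g : ∀ n, G n ↪g H),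
      (∀ n x, g (n + 1) (f n x) = g n x) ∧ ∀ x, ∃ n y, g n y = x := by
  let F : ∀ m n, m ≤ n → (V m ↪ V n) := fun m n h =>
    ⟨Nat.leRecOn h (fun {k} => f k), Nat.leRecOn_injective h _ fun k => (f k).injective⟩
  have F_self : ∀ n (x : V n), F n n le_rfl x = x := fun n x => Nat.leRecOn_self x
  have F_trans : ∀ {i j k} (hij : i ≤ j) (hjk : j ≤ k) (x : V i),
      F j k hjk (F i j hij x) = F i k (hij.trans hjk) x := fun hij hjk x =>
    (Nat.leRecOn_trans hij hjk x).symm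
  have F_succ : ∀ n (x : V n), F n (n + 1) n.le_succ x = f n x := fun n x => Nat.leRecOn_succ' x
  have F_adj : ∀ m n h x y, (G n).Adj (F m n h x) (F m n h y) ↔ (G m).Adj x y := by
    intro m n h
    induction n, h using Nat.le_induction with
    | base => simp [F_self]
    | succ n h ih =>
      intro x y
      rw [← F_trans h n.le_succ, ← F_trans h n.le_succ, F_succ, F_succ, (f n).map_adj_iff, ih]
  have F_sys : DirectedSystem V (F · · ·) := ⟨F_self, fun _ _ _ hij hjk x => F_trans hij hjk x⟩
  let L := _root_.DirectLimit V F
  let mk : ∀ n, V n → L := fun n x => ⟦⟨n, x⟩⟧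
  have mk_inj : ∀ n, Function.Injective (mk n) :=
    _root_.DirectLimit.mk_injective F fun m n h => (F m n h).injective
  have mk_F : ∀ m n h x, mk n (F m n h x) = mk m x := fun m n h x =>
    _root_.DirectLimit.mk_apply (f := F) m n x h
  have mk_surj : ∀ x : L, ∃ n y, mk n y = x := by
    intro x
    obtain ⟨n, y, h⟩ := _root_.DirectLimit.exists_eq_mk F x
    exact ⟨n, y, h.symm⟩
  let H : SimpleGraph L :=
    { Adj := fun x y => ∃ n a b, mk n a = x ∧ mk n b = y ∧ (G n).Adj a b
      symm := ⟨by
        rintro x y ⟨n, a, b, ha, hb, hab⟩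
        exact ⟨n, b, a, hb, ha, hab.symm⟩⟩
      loopless := ⟨by
        rintro x ⟨n, a, b, ha, hb, hab⟩
        exact hab.ne (mk_inj n (ha.trans hb.symm))⟩ }
  have H_adj : ∀ n x y, H.Adj (mk n x) (mk n y) ↔ (G n).Adj x y := by
    intro n x y
    constructor
    · rintro ⟨m, a, b, ha, hb, hab⟩
      rw [← F_adj n (max m n) (le_max_right _ _)]
      rw [← F_adj m (max m n) (le_max_left _ _)] at hab
      rw [← mk_F _ _ (le_max_left m n), ← mk_F _ _ (le_max_right m n)] at ha hb
      rwa [mk_inj _ ha, mk_inj _ hb] at hab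
    · exact fun h => ⟨n, x, y, rfl, rfl, h⟩
  exact ⟨L, H, fun n => ⟨⟨mk n, mk_inj n⟩, H_adj n _ _⟩,
    fun n x => (congrArg _ (F_succ n x).symm).trans (mk_F _ _ _ _), mk_surj⟩

/-- `H`, with the embeddings `g n`, is the union of the chain of the graphs `G n`. -/
structure IsChainLimit {V : ℕ → Type} {G : ∀ n, SimpleGraph (V n)} (f : ∀ n, G n ↪g G (n + 1))
    {L : Type} {H : SimpleGraph L} (g : ∀ n, G n ↪g H) : Prop where
  map_succ : ∀ n x, g (n + 1) (f n x) = g n x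
  exists_eq : ∀ x, ∃ n y, g n y = x

namespace IsChainLimit

variable {V : ℕ → Type} {G : ∀ n, SimpleGraph (V n)} {f : ∀ n, G n ↪g G (n + 1)}
    {L : Type} {H : SimpleGraph L} {g : ∀ n, G n ↪g H}

theorem range_mono (h : IsChainLimit f g) : Monotone fun n => Set.range (g n) := by
  refine monotone_nat_of_le_succ fun n => ?_
  rintro _ ⟨x, rfl⟩
  exact ⟨f n x, h.map_succ n x⟩

theorem exists_comp_eq (h : IsChainLimit f g) {I : Type*} [Finite I] (a : I → L) :
    ∃ n, ∃ b : I → V n, g n ∘ b = a := by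
  choose m y hy using fun i => h.exists_eq (a i)
  obtain ⟨N, hN⟩ := (Set.finite_range m).bddAbove
  choose b hb using fun i => h.range_mono (hN ⟨i, rfl⟩) ⟨y i, hy i⟩
  exact ⟨N, b, funext hb⟩

theorem countable (h : IsChainLimit f g) (hV : ∀ n, Countable (V n)) : Countable L := by
  have : Function.Surjective fun p : Σ n, V n => g p.1 p.2 := fun x => by
    obtain ⟨n, y, hy⟩ := h.exists_eq x
    exact ⟨⟨n, y⟩, hy⟩
  exact this.countable

theorem omits (h : IsChainLimit f g) [∀ i, Finite (W i)]
    (hG : ∀ n, Omits C (G n)) : Omits C H := by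
  rintro i ⟨c⟩
  obtain ⟨n, b, hb⟩ := h.exists_comp_eq c
  refine hG n i ⟨⟨⟨b, fun {x y} hxy => ?_⟩, fun x y hxy => c.injective ?_⟩⟩
  · have := c.toHom.map_adj hxy
    rw [← (g n).map_adj_iff]
    have e := congrFun hb
    simp only [Function.comp_apply] at e
    rw [e, e]
    exact this
  · have e := congrFun hb
    simp only [Function.comp_apply] at e
    exact (e x).symm.trans ((congrArg (g n) hxy).trans (e y))

theorem classG (h : IsChainLimit f g) [∀ i, Finite (W i)]
    (hG : ∀ n, ClassG C (G n)) : ClassG C H :=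
  ⟨h.countable fun n => (hG n).1, h.omits fun n => (hG n).2⟩

/-- An extension of the union also extends the stage containing the parameters. That stage is
existentially complete, and truth there passes up to the union. -/
theorem classE (h : IsChainLimit f g) [∀ i, Finite (W i)]
    (hG : ∀ n, ClassE C (G n)) : ClassE C H := by
  refine ⟨h.classG fun n => (hG n).1, fun V' K e hK m φ a hφ ha => ?_⟩
  obtain ⟨n, b, rfl⟩ := h.exists_comp_eq a
  exact ((hG n).2 V' K (e.comp (g n)) hK m φ b hφ ha).map_embedding hφ (g n)

end IsChainLimit

end Limits

/-! ### Closing off under countably many requirements -/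

section Closure

variable {K : ∀ {V : Type}, SimpleGraph V → Prop}

/-- The class `K` is closed under unions of countable chains. -/
def ClosedUnderChains (K : ∀ {V : Type}, SimpleGraph V → Prop) : Prop :=
  ∀ (V : ℕ → Type) (G : ∀ n, SimpleGraph (V n)) (f : ∀ n, G n ↪g G (n + 1)) (L : Type)
    (H : SimpleGraph L) (g : ∀ n, G n ↪g H), IsChainLimit f g → (∀ n, K (G n)) → K H

/-- A graph in `K` which extends `G`. -/
structure Extension (K : ∀ {V : Type}, SimpleGraph V → Prop) {V : Type} (G : SimpleGraph V) where
  /-- The vertices of the extension. -/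
  carrier : Type
  /-- The extension as a graph. -/
  graph : SimpleGraph carrier
  /-- The embedding in the extension. -/
  emb : G ↪g graph
  mem : K graph

/-- Iteration of extensions: if every extension `X` of `G` in `K` has, for every `n`, an
extension in `K` related to it by `P n`, then there is a chain with union in `K`. -/
theorem exists_chain (hK : ClosedUnderChains K) {V : Type} {G : SimpleGraph V} (hG : K G)
    (P : ∀ (_ : ℕ) (X Y : Extension K G), (X.graph ↪g Y.graph) → Prop)
    (hP : ∀ n X, ∃ Y f, (∀ x, Y.emb x = f (X.emb x)) ∧ P n X Y f) :
    ∃ (X : ℕ → Extension K G) (f : ∀ n, (X n).graph ↪g (X (n + 1)).graph) (Z : Extension K G)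
      (g : ∀ n, (X n).graph ↪g Z.graph), IsChainLimit f g ∧
      (∀ n x, g n ((X n).emb x) = Z.emb x) ∧ ∀ n, P n (X n) (X (n + 1)) (f n) := by
  choose Y f hf hPf using hP
  let X : ℕ → Extension K G := fun n => Nat.rec ⟨V, G, RelEmbedding.refl _, hG⟩ (fun n X => Y n X) n
  obtain ⟨L, H, g, hg, hg'⟩ := exists_limit (fun n => (X n).carrier) (fun n => (X n).graph)
    (fun n => f n (X n))
  have hlim : IsChainLimit (fun n => f n (X n)) g := ⟨hg, hg'⟩
  refine ⟨X, fun n => f n (X n), ⟨L, H, (g 0).comp (X 0).emb, ?_⟩, g, hlim, fun n => ?_,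
    fun n => hPf n (X n)⟩
  · exact hK _ _ _ _ _ _ hlim fun n => (X n).mem
  · induction n with
    | zero => exact fun x => rfl
    | succ n ih =>
      intro x
      rw [← ih x, ← hg n]
      exact congrArg _ (hf n (X n) x)

variable {T : ℕ → Type} [∀ n, Countable (T n)]
  {S : ∀ {V : Type} (_ : SimpleGraph V) {n : ℕ} (_ : Fin n → V) (_ : T n), Prop}

/-- One step of the closure of a graph under countably many requirements `S`. -/
theorem exists_extension_forall_parameters (hK : ClosedUnderChains K)
    (hKc : ∀ (V : Type) (G : SimpleGraph V), K G → Countable V)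
    (mono : ∀ (V V' : Type) (G : SimpleGraph V) (H : SimpleGraph V') (f : G ↪g H), K G → K H →
      ∀ (n : ℕ) (a : Fin n → V) (t : T n), S G a t → S H (f ∘ a) t)
    (step : ∀ (V : Type) (G : SimpleGraph V), K G → ∀ (n : ℕ) (a : Fin n → V) (t : T n),
      ∃ Y : Extension K G, S Y.graph (Y.emb ∘ a) t)
    {V : Type} {G : SimpleGraph V} (hG : K G) :
    ∃ Y : Extension K G, ∀ (n : ℕ) (a : Fin n → V) (t : T n), S Y.graph (Y.emb ∘ a) t := by
  have := hKc V G hG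
  -- Each requirement with parameters in `G` gets its own stage of the chain; the remaining stages
  -- do nothing.
  obtain ⟨e, he⟩ := exists_injective_nat (Σ n, (Fin n → V) × T n)
  obtain ⟨X, f, Z, g, hlim, hZ, hX⟩ := exists_chain hK hG
    (fun k X Y f => ∀ p, e p = k → S Y.graph (Y.emb ∘ p.2.1) p.2.2) (by
      intro k X
      by_cases hk : ∃ p, e p = k
      · obtain ⟨p, rfl⟩ := hk
        obtain ⟨Y, hY⟩ := step _ X.graph X.mem p.1 (X.emb ∘ p.2.1) p.2.2
        refine ⟨⟨Y.carrier, Y.graph, Y.emb.comp X.emb, Y.mem⟩, Y.emb, fun _ => rfl, ?_⟩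
        intro q hq
        obtain rfl := he hq
        exact hY
      · exact ⟨X, RelEmbedding.refl _, fun _ => rfl, fun p hp => (hk ⟨p, hp⟩).elim⟩)
  refine ⟨Z, fun n a t => ?_⟩
  have h := mono _ _ _ _ (g _) (X _).mem Z.mem _ _ _ (hX _ ⟨n, a, t⟩ rfl)
  convert h using 1
  exact funext fun i => (hZ _ _).symm

/-- Every graph in `K` has an extension in `K` which meets all the countably many requirements `S`
with parameters in it. -/
theorem exists_closed_extension (hK : ClosedUnderChains K)
    (hKc : ∀ (V : Type) (G : SimpleGraph V), K G → Countable V)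
    (mono : ∀ (V V' : Type) (G : SimpleGraph V) (H : SimpleGraph V') (f : G ↪g H), K G → K H →
      ∀ (n : ℕ) (a : Fin n → V) (t : T n), S G a t → S H (f ∘ a) t)
    (step : ∀ (V : Type) (G : SimpleGraph V), K G → ∀ (n : ℕ) (a : Fin n → V) (t : T n),
      ∃ Y : Extension K G, S Y.graph (Y.emb ∘ a) t)
    {V : Type} {G : SimpleGraph V} (hG : K G) :
    ∃ Y : Extension K G, ∀ (n : ℕ) (a : Fin n → Y.carrier) (t : T n), S Y.graph a t := by
  -- Parameters from the union appear at some stage `k`; their requirements are met at stage `k + 1`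
  -- and persist by `mono`.
  obtain ⟨X, f, Z, g, hlim, hZ, hX⟩ := exists_chain hK hG
    (fun _ X Y f => ∀ (n : ℕ) (a : Fin n → X.carrier) (t : T n), S Y.graph (f ∘ a) t) (by
      intro k X
      obtain ⟨Y, hY⟩ := exists_extension_forall_parameters hK hKc mono step X.mem
      exact ⟨⟨Y.carrier, Y.graph, Y.emb.comp X.emb, Y.mem⟩, Y.emb, fun _ => rfl, hY⟩)
  refine ⟨Z, fun n a t => ?_⟩
  obtain ⟨k, b, rfl⟩ := hlim.exists_comp_eq a
  have h := mono _ _ _ _ (g (k + 1)) (X _).mem Z.mem _ _ _ (hX k n b t)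
  convert h using 1
  exact funext fun i => (hlim.map_succ _ _).symm

end Closure

/-! ### Ultrapowers, amalgamation and joint embedding -/

section Amalgamation

/-- The ultrapower of a graph. -/
def ultrapower {V : Type} (G : SimpleGraph V) {I : Type} (U : Ultrafilter I) :
    SimpleGraph (Germ (U : Filter I) V) where
  Adj := Germ.LiftRel G.Adj
  symm := ⟨fun x y => Germ.inductionOn₂ x y fun _ _ h =>
    Germ.liftRel_coe.2 ((Germ.liftRel_coe.1 h).mono fun _ => G.symm.symm _ _)⟩
  loopless := ⟨fun x => Germ.inductionOn x fun _ h => by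
    obtain ⟨i, hi⟩ := (Germ.liftRel_coe.1 h).exists
    exact hi.ne rfl⟩

/-- A finite forbidden graph imposes finitely many conditions on representatives, so a single
coordinate meets them all and yields a copy in `G`. -/
theorem omits_ultrapower [∀ i, Finite (W i)] {V : Type} {G : SimpleGraph V} (hG : Omits C G)
    {I : Type} (U : Ultrafilter I) : Omits C (ultrapower G U) := by
  rintro i ⟨c⟩
  have hrep : ∀ w, ∃ r : I → V, (r : Germ (U : Filter I) V) = c w := fun w =>
    Germ.inductionOn (c w) fun r => ⟨r, rfl⟩
  choose r hr using hrep
  have hadj : ∀ᶠ k in (U : Filter I), ∀ x y, (C i).Adj x y → G.Adj (r x k) (r y k) := by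
    simp only [eventually_all]
    intro x y hxy
    have h := c.toHom.map_adj hxy
    change Germ.LiftRel G.Adj (c x) (c y) at h
    rw [← hr, ← hr] at h
    exact h
  have hinj : ∀ᶠ k in (U : Filter I), ∀ x y, r x k = r y k → x = y := by
    simp only [eventually_all]
    intro x y
    by_cases hxy : x = y
    · exact Eventually.of_forall fun _ _ => hxy
    · have h : ¬ ∀ᶠ k in (U : Filter I), r x k = r y k := fun h =>
        hxy (c.injective ((hr x).symm.trans ((Germ.coe_eq.2 h).trans (hr y))))
      exact (Ultrafilter.eventually_not.2 h).mono fun _ h h' => (h h').elim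
  obtain ⟨k, h₁, h₂⟩ := (hadj.and hinj).exists
  exact hG i ⟨⟨⟨fun x => r x k, fun {x y} => h₁ x y⟩, fun x y => h₂ x y⟩⟩

theorem Omits.of_embedding {V V' : Type} {G : SimpleGraph V} {H : SimpleGraph V'} (f : G ↪g H)
    (hH : Omits C H) : Omits C G :=
  fun i h => hH i (h.trans ⟨f.toCopy⟩)

/-- Finite parts of `H` over `b` can be mapped to `G` over `a` when the existential type of `b` is
contained in that of `a`. -/
theorem exists_local_embedding {V V' : Type} {G : SimpleGraph V} {H : SimpleGraph V'} {n : ℕ}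
    {a : Fin n → V} {b : Fin n → V'} (h : existentialType H b ⊆ existentialType G a)
    (s : Finset V') : ∃ F : V' → V, F ∘ b = a ∧ ∀ x ∈ s, ∀ y ∈ s,
      (F x = F y ↔ x = y) ∧ (G.Adj (F x) (F y) ↔ H.Adj x y) := by
  classical
  rcases isEmpty_or_nonempty V' with hV' | ⟨⟨v⟩⟩
  · exact ⟨isEmptyElim, funext fun i => isEmptyElim (b i), isEmptyElim⟩
  -- Adding `v` makes the tuple nonempty, so that some `d j` can serve as the default value of `F`.
  obtain ⟨d, hd⟩ := exists_sameDiagram_of_subset h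
    (fun i => ((insert v s).equivFin.symm i : V'))
  set c : Fin (insert v s).card → V' := fun i => ((insert v s).equivFin.symm i : V')
  have hc : ∀ x ∈ insert v s, ∃ i, c i = x := fun x hx =>
    ⟨(insert v s).equivFin ⟨x, hx⟩, by simp [c]⟩
  obtain ⟨j, -⟩ := hc v (Finset.mem_insert_self _ _)
  have hfac : (Sum.elim a d).FactorsThrough (Sum.elim b c) := fun i j hij => (hd i j).1.1 hij
  have hF := fun i => hfac.extend_apply (fun _ => d j) i
  refine ⟨Function.extend (Sum.elim b c) (Sum.elim a d) (fun _ => d j),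
    funext fun i => hF (Sum.inl i), fun x hx y hy => ?_⟩
  obtain ⟨i, rfl⟩ := hc x (Finset.mem_insert_of_mem hx)
  obtain ⟨k, rfl⟩ := hc y (Finset.mem_insert_of_mem hy)
  have hi := hF (Sum.inr i)
  have hk := hF (Sum.inr k)
  simp only [Sum.elim_inr] at hi hk
  rw [hi, hk]
  exact ⟨(hd (.inr i) (.inr k)).1.symm, (hd (.inr i) (.inr k)).2.symm⟩

/-- Amalgamation over tuples with comparable existential types. -/
theorem exists_amalgam [∀ i, Finite (W i)] {V V' : Type} {G : SimpleGraph V} {H : SimpleGraph V'}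
    (hG : ClassG C G) (hH : Countable V') {n : ℕ} {a : Fin n → V} {b : Fin n → V'}
    (h : existentialType H b ⊆ existentialType G a) :
    ∃ (Z : Type) (K : SimpleGraph Z) (f : G ↪g K) (g : H ↪g K), ClassG C K ∧ f ∘ a = g ∘ b := by
  choose F hFb hF using exists_local_embedding h
  -- Any two vertices of `H` lie in almost every `s`, so the local maps `F s` together define an
  -- embedding into the ultrapower.
  let U : Ultrafilter (Finset V') := Ultrafilter.of atTop
  have hU : (U : Filter (Finset V')) ≤ atTop := Ultrafilter.of_le atTop
  have hmem : ∀ x y : V', ∀ᶠ s in (U : Filter (Finset V')), x ∈ s ∧ y ∈ s := fun x y => hU <| by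
    classical
    filter_upwards [eventually_ge_atTop ({x, y} : Finset V')] with s hs
    exact ⟨hs (by simp), hs (by simp)⟩
  let P := ultrapower G U
  let f : G ↪g P := ⟨⟨fun v => ((fun _ => v : Finset V' → V) : Germ (U : Filter (Finset V')) V),
    fun x y hxy => Germ.const_inj.1 hxy⟩, Germ.liftRel_const_iff⟩
  let g : H ↪g P := ⟨⟨fun v => ((fun s => F s v : Finset V' → V) : Germ (U : Filter (Finset V')) V),
    fun x y hxy => by
      obtain ⟨s, hs, hxs, hys⟩ := ((Germ.coe_eq.1 hxy).and (hmem x y)).exists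
      exact (hF s x hxs y hys).1.1 hs⟩, fun {x y} => by
      refine (Germ.liftRel_coe (r := G.Adj)).trans ⟨fun h => ?_, fun h => ?_⟩
      · obtain ⟨s, hs, hxs, hys⟩ := (h.and (hmem x y)).exists
        exact (hF s x hxs y hys).2.1 hs
      · exact (hmem x y).mono fun s hs => (hF s x hs.1 y hs.2).2.2 h⟩
  have hP : Omits C P := omits_ultrapower hG.2 U
  -- The ultrapower may be uncountable; the two images suffice.
  let Z : Set (Germ (U : Filter (Finset V')) V) := Set.range f ∪ Set.range g
  have := hG.1
  have hZ : Countable Z := ((Set.countable_range f).union (Set.countable_range g)).to_subtype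
  refine ⟨Z, P.induce Z, ⟨⟨fun v => ⟨f v, .inl ⟨v, rfl⟩⟩, fun x y hxy => ?_⟩, f.map_adj_iff⟩,
    ⟨⟨fun v => ⟨g v, .inr ⟨v, rfl⟩⟩, fun x y hxy => ?_⟩, g.map_adj_iff⟩,
    ⟨hZ, hP.of_embedding (SimpleGraph.Embedding.induce Z)⟩, funext fun i => Subtype.ext ?_⟩
  · exact f.injective (congrArg Subtype.val hxy)
  · exact g.injective (congrArg Subtype.val hxy)
  · exact Germ.coe_eq.2 (Eventually.of_forall fun s => (congrFun (hFb s) i).symm)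

/-- Joint embedding. -/
theorem classG_sum (hC : ∀ i, (C i).Connected) {V V' : Type} {G : SimpleGraph V}
    {H : SimpleGraph V'} (hG : ClassG C G) (hH : ClassG C H) : ClassG C (G ⊕g H) := by
  have := hG.1
  have := hH.1
  refine ⟨inferInstance, ?_⟩
  rintro i ⟨c⟩
  -- No edge joins the two summands, so a connected copy lies in one of them.
  have hside : ∀ x y, (C i).Adj x y → (c x).isLeft = (c y).isLeft := by
    intro x y hxy
    have h : (G ⊕g H).Adj (c x) (c y) := c.toHom.map_adj hxy
    rcases hx : c x with p | p <;> rcases hy : c y with q | q <;> simp [hx, hy] at h ⊢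
  have hside' : ∀ x y, (c x).isLeft = (c y).isLeft := by
    intro x y
    obtain ⟨p⟩ := (hC i).preconnected x y
    induction p with
    | nil => rfl
    | cons hadj _ ih => exact (hside _ _ hadj).trans ih
  obtain ⟨x₀⟩ := (hC i).nonempty
  have hadj : ∀ {x y}, (C i).Adj x y → (G ⊕g H).Adj (c x) (c y) := fun hxy => c.toHom.map_adj hxy
  rcases h₀ : c x₀ with v₀ | v₀
  · have hl : ∀ x, ∃ v, c x = Sum.inl v := fun x => by
      have := hside' x x₀
      rw [h₀] at this
      exact Sum.isLeft_iff.1 this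
    choose v hv using hl
    refine hG.2 i ⟨⟨⟨v, fun {x y} hxy => ?_⟩, fun x y hxy => c.injective ?_⟩⟩
    · have h := hadj hxy
      rw [hv, hv] at h
      exact h
    · exact (hv x).trans ((congrArg Sum.inl hxy).trans (hv y).symm)
  · have hl : ∀ x, ∃ v, c x = Sum.inr v := fun x => by
      have := hside' x x₀
      rw [h₀] at this
      exact Sum.isRight_iff.1 (by simpa using this)
    choose v hv using hl
    refine hH.2 i ⟨⟨⟨v, fun {x y} hxy => ?_⟩, fun x y hxy => c.injective ?_⟩⟩
    · have h := hadj hxy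
      rw [hv, hv] at h
      exact h
    · exact (hv x).trans ((congrArg Sum.inr hxy).trans (hv y).symm)

end Amalgamation

/-! ### Existentially complete and saturated extensions -/

section ExistentiallyComplete

theorem ClassE.existentialType_map {V V' : Type} {G : SimpleGraph V} {H : SimpleGraph V'}
    (hG : ClassE C G) (hH : ClassG C H) (f : G ↪g H) {n : ℕ} (a : Fin n → V) :
    existentialType H (f ∘ a) = existentialType G a :=
  existentialType_map_eq (hG.2 _ H f hH) a

/-- All graphs of `ℰ_C` satisfy the same existential sentences. -/
theorem ClassE.existentialType_empty_eq (hC : ∀ i, (C i).Connected) {V V' : Type}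
    {G : SimpleGraph V} {H : SimpleGraph V'} (hG : ClassE C G) (hH : ClassE C H)
    (a : Fin 0 → V) (b : Fin 0 → V') : existentialType G a = existentialType H b := by
  have hsum := classG_sum hC hG.1 hH.1
  rw [← hG.existentialType_map hsum SimpleGraph.Embedding.sumInl a,
    ← hH.existentialType_map hsum SimpleGraph.Embedding.sumInr b]
  exact congrArg _ (Subsingleton.elim _ _)

theorem classG_empty (hC : ∀ i, (C i).Connected) : ClassG C (⊥ : SimpleGraph Empty) :=
  ⟨inferInstance, fun i ⟨c⟩ => (c (hC i).nonempty.some).elim⟩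

theorem countable_existentialFormula (n : ℕ) :
    Countable {φ : Language.graph.Formula (Fin n) // IsExistential φ} := by
  have : Countable Language.graph.Symbols := by
    have h₁ : Countable (Σ l, Language.graph.Functions l) :=
      inferInstanceAs (Countable (Σ _ : ℕ, Empty))
    have h₂ : Countable (Σ l, Language.graph.Relations l) := by
      refine (Function.Injective.countable (f := fun p => p.1) ?_)
      rintro ⟨_, r⟩ ⟨_, s⟩ h
      obtain rfl : _ = _ := h
      exact congrArg _ (Subsingleton.elim _ _)
    exact inferInstanceAs (Countable (_ ⊕ _))
  infer_instance

variable [∀ i, Finite (W i)]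

/-- Every graph of `𝒢_C` is an induced subgraph of a graph of `ℰ_C`. -/
theorem exists_classE_extension {V : Type} {G : SimpleGraph V} (hG : ClassG C G) :
    ∃ (Z : Type) (K : SimpleGraph Z), ClassE C K ∧ Nonempty (G ↪g K) := by
  have := countable_existentialFormula
  -- The requirement: `φ` holds at `a`, or fails there in every extension in `ClassG C`. Both
  -- alternatives persist.
  obtain ⟨Y, hY⟩ := exists_closed_extension (K := ClassG C)
    (T := fun n => {φ : Language.graph.Formula (Fin n) // IsExistential φ})
    (S := fun {V} G {n} a φ => Sat G φ.1 a ∨ ∀ (V' : Type) (H : SimpleGraph V') (f : G ↪g H),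
      ClassG C H → ¬ Sat H φ.1 (f ∘ a))
    (fun V G f L H g hlim hK => hlim.classG hK) (fun _ _ h => h.1)
    (by
      rintro V V' G H f - - n a ⟨φ, hφ⟩ (h | h)
      · exact .inl (h.map_embedding hφ f)
      · exact .inr fun V'' K g hK => h V'' K (g.comp f) hK)
    (by
      rintro V G hG n a ⟨φ, hφ⟩
      by_cases h : ∃ (V' : Type) (H : SimpleGraph V') (f : G ↪g H), ClassG C H ∧ Sat H φ (f ∘ a)
      · obtain ⟨V', H, f, hH, h⟩ := h
        exact ⟨⟨V', H, f, hH⟩, .inl h⟩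
      · push Not at h
        exact ⟨⟨V, G, RelEmbedding.refl _, hG⟩, .inr h⟩)
    hG
  refine ⟨Y.carrier, Y.graph, ⟨Y.mem, fun V' H f hH n φ a hφ ha => ?_⟩, ⟨Y.emb⟩⟩
  exact (hY n a ⟨φ, hφ⟩).resolve_right fun h => h V' H f hH ha

/-- Types over tuples in a graph of `ℰ_C` are realized in an extension in `ℰ_C`. -/
theorem ClassE.exists_extension_realizing {V : Type} {G : SimpleGraph V} (hG : ClassE C G) {n : ℕ}
    (a : Fin n → V) {p : Set (Language.graph.Formula (Fin (n + 1)))} (hp : p ∈ typeSpace C (n + 1))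
    (h : restrictType p = existentialType G a) :
    ∃ (Y : Extension (ClassE C) G) (v : Y.carrier),
      existentialType Y.graph (Fin.snoc (Y.emb ∘ a) v : Fin (n + 1) → Y.carrier) = p := by
  obtain ⟨V', H, b, hH, rfl⟩ := hp
  rw [restrictType_existentialType] at h
  obtain ⟨Z, K, f, g, hK, hfg⟩ := exists_amalgam hG.1 hH.1.1 h.subset
  obtain ⟨Z', K', hK', ⟨e⟩⟩ := exists_classE_extension hK
  refine ⟨⟨Z', K', e.comp f, hK'⟩, e (g (b (Fin.last n))), ?_⟩
  -- The type of `b` is unchanged in `K'`, since `H` is existentially complete.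
  rw [← hH.existentialType_map hK'.1 (e.comp g) b]
  congr 1
  funext i
  refine Fin.lastCases ?_ (fun j => ?_) i
  · simp
  · simpa using congrArg e (congrFun hfg j)

theorem exists_isSaturated (hC : ∀ i, (C i).Connected)
    (hcount : ∀ n : ℕ, (typeSpace C n).Countable) :
    ∃ (V : Type) (G : SimpleGraph V), IsSaturated C G := by
  obtain ⟨V, G, hG, -⟩ := exists_classE_extension (classG_empty hC)
  have (n : ℕ) : Countable (typeSpace C (n + 1)) := (hcount (n + 1)).to_subtype
  obtain ⟨Y, hY⟩ := exists_closed_extension (K := ClassE C)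
    (T := fun n => typeSpace C (n + 1))
    (S := fun {V} G {n} a p => restrictType p.1 = existentialType G a →
      ∃ v : V, existentialType G (Fin.snoc a v : Fin (n + 1) → V) = p.1)
    (fun V G f L H g hlim hK => hlim.classE hK) (fun _ _ h => h.1.1)
    (by
      intro V V' G H f hG hH n a p h hp
      rw [hG.existentialType_map hH.1] at hp
      obtain ⟨v, hv⟩ := h hp
      refine ⟨f v, ?_⟩
      rw [← hv, ← hG.existentialType_map hH.1 f, Fin.comp_snoc])
    (by
      intro V G hG n a p
      by_cases hp : restrictType p.1 = existentialType G a
      · obtain ⟨Y, v, hv⟩ := hG.exists_extension_realizing a p.2 hp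
        exact ⟨Y, fun _ => ⟨v, hv⟩⟩
      · exact ⟨⟨V, G, RelEmbedding.refl _, hG⟩, fun h => (hp h).elim⟩)
    hG
  exact ⟨Y.carrier, Y.graph, Y.mem, fun n a p hp => hY n a ⟨p, hp⟩⟩

end ExistentiallyComplete

/-! ### Back-and-forth -/

section BackAndForth

/-- Back-and-forth construction. The range of the embedding contains the set `B` for which the
"back" condition holds. -/
theorem exists_embedding_of_back_and_forth {V V' : Type} [Countable V] [Countable V']
    {G : SimpleGraph V} {H : SimpleGraph V'} (R : ∀ n, (Fin n → V) → (Fin n → V') → Prop)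
    (sameDiagram : ∀ n a b, R n a b → SameDiagram G a H b) (start : ∃ a b, R 0 a b)
    (forth : ∀ n a b, R n a b → ∀ x, ∃ y, R (n + 1) (Fin.snoc a x) (Fin.snoc b y))
    (B : Set V') (back : ∀ n a b, R n a b → ∀ y ∈ B, ∃ x, R (n + 1) (Fin.snoc a x) (Fin.snoc b y)) :
    ∃ f : G ↪g H, B ⊆ Set.range f := by
  let P := {p : Σ n, (Fin n → V) × (Fin n → V') // R p.1 p.2.1 p.2.2}
  let graphOf : P → Set (V × V') := fun p => Set.range fun i => (p.1.2.1 i, p.1.2.2 i)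
  -- Finite partial maps are ordered by inclusion of graphs. An ideal meeting the cofinal sets `D`
  -- defines a total map whose range contains `B`.
  let : Preorder P := Preorder.lift graphOf
  have hdiag : ∀ p : P, ∀ z ∈ graphOf p, ∀ z' ∈ graphOf p,
      (z.1 = z'.1 ↔ z.2 = z'.2) ∧ (G.Adj z.1 z'.1 ↔ H.Adj z.2 z'.2) := by
    rintro p _ ⟨i, rfl⟩ _ ⟨j, rfl⟩
    exact sameDiagram _ _ _ p.2 i j
  have hsnoc : ∀ (p : P) (x : V) (y : V')
      (h : R (p.1.1 + 1) (Fin.snoc p.1.2.1 x) (Fin.snoc p.1.2.2 y)),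
      p ≤ ⟨⟨p.1.1 + 1, Fin.snoc p.1.2.1 x, Fin.snoc p.1.2.2 y⟩, h⟩ ∧
        (x, y) ∈ graphOf ⟨⟨p.1.1 + 1, Fin.snoc p.1.2.1 x, Fin.snoc p.1.2.2 y⟩, h⟩ := by
    refine fun p x y h => ⟨?_, ⟨Fin.last _, by simp⟩⟩
    rintro _ ⟨i, rfl⟩
    exact ⟨i.castSucc, by simp⟩
  let D : V ⊕ B → Order.Cofinal P := fun z => match z with
    | .inl x => ⟨{p | ∃ y, (x, y) ∈ graphOf p}, fun p => by
        obtain ⟨y, hy⟩ := forth _ _ _ p.2 x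
        exact ⟨_, ⟨y, (hsnoc p x y hy).2⟩, (hsnoc p x y hy).1⟩⟩
    | .inr y => ⟨{p | ∃ x, (x, y.1) ∈ graphOf p}, fun p => by
        obtain ⟨x, hx⟩ := back _ _ _ p.2 y.1 y.2
        exact ⟨_, ⟨x, (hsnoc p x y hx).2⟩, (hsnoc p x y hx).1⟩⟩
  let : Encodable (V ⊕ B) := Encodable.ofCountable _
  obtain ⟨a₀, b₀, h₀⟩ := start
  let I := Order.idealOfCofinals (⟨⟨0, a₀, b₀⟩, h₀⟩ : P) D
  have hmeet := Order.cofinal_meets_idealOfCofinals (⟨⟨0, a₀, b₀⟩, h₀⟩ : P) D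
  have hI : ∀ p ∈ I, ∀ q ∈ I, ∀ z ∈ graphOf p, ∀ z' ∈ graphOf q,
      (z.1 = z'.1 ↔ z.2 = z'.2) ∧ (G.Adj z.1 z'.1 ↔ H.Adj z.2 z'.2) := by
    intro p hp q hq z hz z' hz'
    obtain ⟨r, -, hpr, hqr⟩ := I.directed p hp q hq
    exact hdiag r z (hpr hz) z' (hqr hz')
  have hF : ∀ x, ∃ y, ∃ p ∈ I, (x, y) ∈ graphOf p := fun x => by
    obtain ⟨p, ⟨y, hy⟩, hp⟩ := hmeet (.inl x)
    exact ⟨y, p, hp, hy⟩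
  choose F p hp hFp using hF
  refine ⟨⟨⟨F, fun x x' h => (hI _ (hp x) _ (hp x') _ (hFp x) _ (hFp x')).1.2 h⟩,
    fun {x x'} => (hI _ (hp x) _ (hp x') _ (hFp x) _ (hFp x')).2.symm⟩, fun y hy => ?_⟩
  obtain ⟨q, ⟨x, hx⟩, hq⟩ := hmeet (.inr ⟨y, hy⟩)
  exact ⟨x, (hI _ (hp x) q hq _ (hFp x) _ hx).1.1 rfl⟩

end BackAndForth

/-! ### Universality and uniqueness of saturated graphs -/

section Saturated

variable {V V' : Type} {G : SimpleGraph V} {H : SimpleGraph V'}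

theorem IsSaturated.exists_snoc (hG : IsSaturated C G) (hH : ClassE C H) {n : ℕ} {a : Fin n → V}
    {b : Fin n → V'} (h : existentialType H b = existentialType G a) (y : V') :
    ∃ x, existentialType H (Fin.snoc b y : Fin (n + 1) → V') =
      existentialType G (Fin.snoc a x : Fin (n + 1) → V) := by
  obtain ⟨x, hx⟩ := hG.2 n a (existentialType H (Fin.snoc b y : Fin (n + 1) → V'))
    ⟨V', H, _, hH, rfl⟩ (by
      rw [restrictType_existentialType, ← h]
      exact congrArg _ (funext fun i => Fin.snoc_castSucc (α := fun _ => V') y b i))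
  exact ⟨x, hx.symm⟩

/-- Only the forth direction is needed, so `H` need not be saturated and `B` is empty. -/
theorem IsSaturated.nonempty_embedding (hC : ∀ i, (C i).Connected) (hG : IsSaturated C G)
    (hH : ClassE C H) : Nonempty (H ↪g G) := by
  have := hG.1.1.1
  have := hH.1.1
  obtain ⟨f, -⟩ := exists_embedding_of_back_and_forth (G := H) (H := G)
    (fun _ b a => existentialType H b = existentialType G a)
    (fun _ _ _ h => sameDiagram_of_existentialType_eq h)
    ⟨Fin.elim0, Fin.elim0, hH.existentialType_empty_eq hC hG.1 _ _⟩
    (fun _ _ _ h y => hG.exists_snoc hH h y) ∅ (fun _ _ _ _ _ h => h.elim)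
  exact ⟨f⟩

theorem IsSaturated.nonempty_iso (hC : ∀ i, (C i).Connected) (hG : IsSaturated C G)
    (hH : IsSaturated C H) : Nonempty (H ≃g G) := by
  have := hG.1.1.1
  have := hH.1.1.1
  obtain ⟨f, hf⟩ := exists_embedding_of_back_and_forth (G := H) (H := G)
    (fun _ b a => existentialType H b = existentialType G a)
    (fun _ _ _ h => sameDiagram_of_existentialType_eq h)
    ⟨Fin.elim0, Fin.elim0, hH.1.existentialType_empty_eq hC hG.1 _ _⟩
    (fun _ _ _ h y => hG.exists_snoc hH.1 h y) Set.univ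
    (fun _ _ _ h x _ => (hH.exists_snoc hG.1 h.symm x).imp fun _ => Eq.symm)
  exact ⟨RelIso.ofSurjective f fun y => hf (Set.mem_univ y)⟩

theorem typeSpace_countable_of_isUniversalIn (hG : IsUniversalIn (ClassE C) G) (n : ℕ) :
    (typeSpace C n).Countable := by
  have := hG.1.1.1
  refine (Set.countable_range fun a : Fin n → V => existentialType G a).mono ?_
  rintro _ ⟨V', H, b, hH, rfl⟩
  obtain ⟨f⟩ := hG.2 V' H hH
  exact ⟨f ∘ b, hH.existentialType_map hG.1.1 f b⟩

end Saturated

end ForbiddenGraphs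

open ForbiddenGraphs in
theorem theorem2 {ι : Type*} [Finite ι] {W : ι → Type*} [∀ i, Finite (W i)]
    (C : ∀ i, SimpleGraph (W i)) (hC : ∀ i, (C i).Connected) :
    List.TFAE [
      ∃ (V : Type) (G : SimpleGraph V), IsUniversalIn (ClassG C) G,
      ∃ (V : Type) (G : SimpleGraph V), IsUniversalIn (ClassE C) G,
      ∃ (V : Type) (G : SimpleGraph V), IsSaturated C G ∧
        ∀ (V' : Type) (G' : SimpleGraph V'), IsSaturated C G' → Nonempty (G' ≃g G),
      ∀ n : ℕ, (typeSpace C n).Countable] := by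
  tfae_have 1 → 2 := by
    rintro ⟨V, G, hG, huniv⟩
    obtain ⟨Z, K, hK, ⟨e⟩⟩ := exists_classE_extension hG
    -- An extension of a universal graph still receives every embedding.
    exact ⟨Z, K, hK, fun V' H hH => (huniv V' H hH.1).map e.comp⟩
  tfae_have 2 → 1 := by
    rintro ⟨V, G, hG, huniv⟩
    refine ⟨V, G, hG.1, fun V' H hH => ?_⟩
    obtain ⟨Z, K, hK, ⟨e⟩⟩ := exists_classE_extension hH
    exact (huniv Z K hK).map fun f => f.comp e
  tfae_have 2 → 4 := fun ⟨_, _, hG⟩ => typeSpace_countable_of_isUniversalIn hG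
  tfae_have 4 → 3 := fun h => by
    obtain ⟨V, G, hG⟩ := exists_isSaturated hC h
    exact ⟨V, G, hG, fun V' G' hG' => hG.nonempty_iso hC hG'⟩
  tfae_have 3 → 2 := fun ⟨V, G, hG, _⟩ =>
    ⟨V, G, hG.1, fun _ _ hH => hG.nonempty_embedding hC hH⟩
  tfae_finish
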